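/- Let $\mathcal H$ be a complex separable Hilbert space and let $T$ be a bounded linear operator on $\mathcal H$ with $\|T\|\le 1$ which is irreducible, i.e. the only closed subspaces $\mathcal N\subseteq\mathcal H$ with $T\mathcal N\subseteq\mathcal N$ and $T\mathcal N^{\perp}\subseteq\mathcal N^{\perp}$ are $\{0\}$ and $\mathcal H$. Let $\mathbb D$ be the open unit disk. Suppose that there are a closed $T$-invariant subspace $\mathcal M$ of $\mathcal H$ and a positive integer $k$ such that the restriction $S=T|_{\mathcal M}$ belongs to the Cowen–Douglas class $B_1(\mathbb D)$, i.e. for all $\omega\in\mathbb D$ the operator $S-\omega$ maps $\mathcal M$ onto $\mathcal M$ and $\dim\ker(S-\omega)=1$, and the linear span of $\bigcup_{\omega\in\mathbb D}\ker(S-\omega)$ is dense in $\mathcal M$; and such that $$\mathcal K_{S}(\omega)=\frac{-k}{(1-|\omega|^2)^2}\qquad(\omega\in\mathbb D).$$ Here $\mathcal K_S(\omega)=-\frac{\partial}{\partial\bar\omega}\Big(h(\omega)^{-1}\frac{\partial h}{\partial\omega}(\omega)\Big)$, with $h(\omega)=\|\gamma(\omega)\|^2$ for a nowhere vanishing holomorphic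 local section $\gamma$, $\gamma(\omega)\in\ker(S-\omega)$; this does not depend on the choice of $\gamma$. Then $T$ is not subnormal, i.e. there are no Hilbert space $\mathcal L\supseteq\mathcal H$ and normal operator $N$ on $\mathcal L$ with $N\mathcal H\subseteq\mathcal H$ and $N|_{\mathcal H}=T$. -/

import Mathlib

open Filter Topology ComplexConjugate

noncomputable section

/-! ### Wirtinger derivatives -/

/-- The Wirtinger derivative `∂f/∂z = (∂f/∂x - i ∂f/∂y) / 2`. -/
def wirtinger (f : ℂ → ℂ) (z : ℂ) : ℂ :=
  (fderiv ℝ f z 1 - Complex.I * fderiv ℝ f z Complex.I) / 2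

/-- The conjugate Wirtinger derivative `∂f/∂z̄ = (∂f/∂x + i ∂f/∂y) / 2`. -/
def wirtingerBar (f : ℂ → ℂ) (z : ℂ) : ℂ :=
  (fderiv ℝ f z 1 + Complex.I * fderiv ℝ f z Complex.I) / 2

section Operators

universe u

variable {E : Type u} [NormedAddCommGroup E] [InnerProductSpace ℂ E]

/-! ### The Cowen-Douglas class -/

/-- The class `B_n(Ω)` of bounded operators `T` such that, for every `ω ∈ Ω`, `T - ω` is surjective
with `n`-dimensional kernel, and such that these kernels span a dense subspace. -/
structure IsCowenDouglas (n : ℕ) (Ω : Set ℂ) (T : E →L[ℂ] E) : Prop where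
  isOpen : IsOpen Ω
  isBounded : Bornology.IsBounded Ω
  surjective : ∀ ω ∈ Ω, Function.Surjective (T - ω • (1 : E →L[ℂ] E))
  rank_ker : ∀ ω ∈ Ω, Module.rank ℂ (T - ω • (1 : E →L[ℂ] E)).ker = n
  dense_span : (⨆ ω ∈ Ω, (T - ω • (1 : E →L[ℂ] E)).ker).topologicalClosure = ⊤

/-! ### The eigenvector line bundle of an operator of index one, and its curvature -/

/-- `γ` is, on a neighbourhood of `ω`, a holomorphic nowhere vanishing section of the eigenvector
bundle `z ↦ ker (T - z)`; for an operator of index one this is a holomorphic frame near `ω`. -/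
structure IsFrameAt (T : E →L[ℂ] E) (γ : ℂ → E) (ω : ℂ) : Prop where
  holo : ∀ᶠ z in 𝓝 ω, DifferentiableAt ℂ γ z
  mem_ker : ∀ᶠ z in 𝓝 ω, γ z ∈ (T - z • (1 : E →L[ℂ] E)).ker
  ne_zero : ∀ᶠ z in 𝓝 ω, γ z ≠ 0

/-- The metric `h(z) = ⟨γ(z), γ(z)⟩ = ‖γ(z)‖²` of a section. -/
def frameMetric (γ : ℂ → E) (z : ℂ) : ℂ := inner ℂ (γ z) (γ z)

/-- The curvature `-∂/∂ω̄ (h⁻¹ ∂h/∂ω)` computed in the frame `γ`. -/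
def frameCurvature (γ : ℂ → E) (ω : ℂ) : ℂ :=
  -wirtingerBar (fun z => (frameMetric γ z)⁻¹ * wirtinger (frameMetric γ) z) ω

open Classical in
/-- The curvature at `ω` of the eigenvector line bundle of an operator of index one, computed in
some holomorphic frame near `ω`. For `T ∈ B_1(Ω)` and `ω ∈ Ω`, frames exist
(`IsCowenDouglas.exists_isFrameAt`) and the value does not depend on the choice of the frame
(`IsCowenDouglas.curvature_eq`). -/
def curvature (T : E →L[ℂ] E) (ω : ℂ) : ℂ :=
  if h : ∃ γ : ℂ → E, IsFrameAt T γ ω then frameCurvature h.choose ω else 0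

/-! #### The curvature is well defined -/

theorem IsCowenDouglas.exists_isFrameAt [CompleteSpace E] {Ω : Set ℂ} {T : E →L[ℂ] E}
    (hT : IsCowenDouglas 1 Ω T) {ω : ℂ} (hω : ω ∈ Ω) : ∃ γ : ℂ → E, IsFrameAt T γ ω := by
  set S := T - ω • (1 : E →L[ℂ] E) with hS
  have : CompleteSpace S.ker := S.isClosed_ker.completeSpace_coe
  set P := S.ker.orthogonalProjectionOnto with hP
  have hPsurj : P.range = ⊤ := LinearMap.range_eq_top.2 fun x =>
    ⟨x, Submodule.orthogonalProjectionOnto_mem_subspace_eq_self x⟩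
  have hPker : P.ker = S.kerᗮ := Submodule.ker_orthogonalProjectionOnto
  have hc : IsCompl S.ker P.ker := hPker ▸ Submodule.isCompl_orthogonal _
  let e : E ≃L[ℂ] E × S.ker := S.equivProdOfSurjectiveOfIsCompl P
    (LinearMap.range_eq_top.2 (hT.surjective ω hω)) hPsurj hc
  let A : ℂ → (E →L[ℂ] E × S.ker) := fun z => (T - z • (1 : E →L[ℂ] E)).prod P
  have hA : A ω = (e : E →L[ℂ] E × S.ker) := rfl
  have hAd : Differentiable ℂ A := by
    have : A = fun z => A 0 - z • ContinuousLinearMap.inl ℂ E S.ker := by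
      funext z; ext x <;> simp [A]
    rw [this]
    have h : Differentiable ℂ fun z : ℂ => z • ContinuousLinearMap.inl ℂ E S.ker :=
      (ContinuousLinearMap.toSpanSingleton (M₁ := E →L[ℂ] E × S.ker) ℂ
        (ContinuousLinearMap.inl ℂ E S.ker)).differentiable
    exact Differentiable.const_sub (𝕜 := ℂ) (E := ℂ) (F := E →L[ℂ] E × S.ker) h _
  have hfin : Module.finrank ℂ S.ker = 1 :=
    Module.rank_eq_one_iff_finrank_eq_one.1 ((hT.rank_ker ω hω).trans Nat.cast_one)
  have : Nontrivial S.ker := Module.nontrivial_of_finrank_pos (R := ℂ) (by omega)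
  obtain ⟨v, hv⟩ := exists_ne (0 : S.ker)
  have hev : ∀ᶠ z in 𝓝 ω, ∃ e' : E ≃L[ℂ] E × S.ker, (e' : E →L[ℂ] E × S.ker) = A z :=
    hAd.continuous.continuousAt.eventually (hA ▸ e.nhds)
  have key : ∀ᶠ z in 𝓝 ω, A z ((A z).inverse (0, v)) = (0, v) := by
    filter_upwards [hev] with z ⟨e', he'⟩
    rw [← he']; simp
  refine ⟨fun z => (A z).inverse (0, v), ?_, ?_, ?_⟩
  · filter_upwards [hev] with z ⟨e', he'⟩
    have h1 : DifferentiableAt ℂ (ContinuousLinearMap.inverse (R := ℂ)) (A z) :=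
      he' ▸ (contDiffAt_map_inverse (𝕜 := ℂ) (n := 1) e').differentiableAt (by simp)
    have h2 : DifferentiableAt ℂ (ContinuousLinearMap.inverse ∘ A) z :=
      DifferentiableAt.comp (𝕜 := ℂ) (F := E →L[ℂ] E × S.ker) (G := E × S.ker →L[ℂ] E) z h1 (hAd z)
    exact h2.clm_apply (differentiableAt_const _)
  · filter_upwards [key] with z hz
    exact congrArg Prod.fst hz
  · filter_upwards [key] with z hz h0
    rw [h0, map_zero] at hz
    exact hv (congrArg Prod.snd hz).symm

theorem fderiv_real_apply {F : Type*} [NormedAddCommGroup F] [NormedSpace ℂ F] {f : ℂ → F} {z : ℂ}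
    (hf : DifferentiableAt ℂ f z) (w : ℂ) : fderiv ℝ f z w = w • deriv f z := by
  rw [(hf.hasFDerivAt.restrictScalars ℝ).fderiv]
  simp

theorem wirtinger_frameMetric {γ : ℂ → E} {z : ℂ} (hγ : DifferentiableAt ℂ γ z) :
    wirtinger (frameMetric γ) z = inner ℂ (γ z) (deriv γ z) := by
  have hr : DifferentiableAt ℝ γ z := hγ.restrictScalars ℝ
  have h : ∀ w : ℂ, fderiv ℝ (frameMetric γ) z w
      = w * inner ℂ (γ z) (deriv γ z) + conj w * inner ℂ (deriv γ z) (γ z) := fun w => by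
    have := fderiv_inner_apply ℂ hr hr w
    rw [fderiv_real_apply hγ, inner_smul_left, inner_smul_right] at this
    exact this
  rw [wirtinger, h, h]
  simp only [map_one, Complex.conj_I]
  linear_combination (inner ℂ (deriv γ z) (γ z) / 2 - inner ℂ (γ z) (deriv γ z) / 2) * Complex.I_sq

theorem IsCowenDouglas.frameCurvature_eq [CompleteSpace E] {Ω : Set ℂ} {T : E →L[ℂ] E}
    (hT : IsCowenDouglas 1 Ω T) {ω : ℂ} (hω : ω ∈ Ω) {γ₁ γ₂ : ℂ → E} (h₁ : IsFrameAt T γ₁ ω) (h₂ : IsFrameAt T γ₂ ω) :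
    frameCurvature γ₂ ω = frameCurvature γ₁ ω := by
  set f : ℂ → ℂ := fun z => inner ℂ (γ₁ ω) (γ₂ z) / inner ℂ (γ₁ ω) (γ₁ z) with hf
  have hlin : ∀ {γ : ℂ → E} {z : ℂ}, DifferentiableAt ℂ γ z →
      DifferentiableAt ℂ (fun z => inner ℂ (γ₁ ω) (γ z)) z := fun h =>
    (innerSL ℂ (γ₁ ω)).differentiableAt.comp _ h
  have hne : ∀ᶠ z in 𝓝 ω, inner ℂ (γ₁ ω) (γ₁ z) ≠ 0 :=
    (hlin h₁.holo.self_of_nhds).continuousAt.eventually_ne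
      (inner_self_ne_zero.2 h₁.ne_zero.self_of_nhds)
  have hfγ : ∀ᶠ z in 𝓝 ω, γ₂ z = f z • γ₁ z := by
    filter_upwards [hT.isOpen.mem_nhds hω, h₁.mem_ker, h₂.mem_ker, h₁.ne_zero, hne]
      with z hz h1 h2 h0 hne
    have hfin : Module.finrank ℂ (T - z • (1 : E →L[ℂ] E)).ker = 1 :=
      Module.rank_eq_one_iff_finrank_eq_one.1 ((hT.rank_ker z hz).trans Nat.cast_one)
    obtain ⟨c, hc⟩ := (finrank_eq_one_iff_of_nonzero' ⟨γ₁ z, h1⟩ (fun h => h0 (congrArg Subtype.val h))).1 hfin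
      ⟨γ₂ z, h2⟩
    have hc : γ₂ z = c • γ₁ z := (congrArg Subtype.val hc).symm
    have : f z = c := by
      simp only [hf, hc, inner_smul_right]
      field_simp
    rw [this, hc]
  have hfd : ∀ᶠ z in 𝓝 ω, DifferentiableAt ℂ f z := by
    filter_upwards [h₁.holo, h₂.holo, hne] with z h1 h2 hne
    exact (hlin h2).div (hlin h1) hne
  have hf0 : ∀ᶠ z in 𝓝 ω, f z ≠ 0 := by
    filter_upwards [hfγ, h₂.ne_zero] with z hz h2 h0
    rw [h0, zero_smul] at hz
    exact h2 hz
  have hfd' : DifferentiableAt ℂ (deriv f) ω :=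
    (Complex.analyticAt_iff_eventually_differentiableAt.2 hfd).deriv.differentiableAt
  have hγd' : DifferentiableAt ℂ (deriv γ₁) ω :=
    (Complex.analyticAt_iff_eventually_differentiableAt.2 h₁.holo).deriv.differentiableAt
  have heq₁ : (fun z => (frameMetric γ₁ z)⁻¹ * wirtinger (frameMetric γ₁) z)
      =ᶠ[𝓝 ω] fun z => (frameMetric γ₁ z)⁻¹ * inner ℂ (γ₁ z) (deriv γ₁ z) := by
    filter_upwards [h₁.holo] with z hz
    rw [wirtinger_frameMetric hz]
  have heq₂ : (fun z => (frameMetric γ₂ z)⁻¹ * wirtinger (frameMetric γ₂) z)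
      =ᶠ[𝓝 ω] fun z => deriv f z / f z + (frameMetric γ₁ z)⁻¹ * inner ℂ (γ₁ z) (deriv γ₁ z) := by
    filter_upwards [h₁.holo, h₂.holo, hfγ.eventually_nhds, hfd, hf0, h₁.ne_zero]
      with z hz1 hz2 hz hfz hf0 hγ0
    have hder : deriv γ₂ z = f z • deriv γ₁ z + deriv f z • γ₁ z := by
      have he : γ₂ =ᶠ[𝓝 z] fun y => f y • γ₁ y := hz
      rw [he.deriv_eq]
      exact deriv_fun_smul hfz hz1
    have hi : inner ℂ (γ₁ z) (γ₁ z) ≠ 0 := inner_self_ne_zero.2 hγ0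
    have hcf : conj (f z) ≠ 0 := (map_ne_zero _).2 hf0
    rw [wirtinger_frameMetric hz2, hder]
    simp only [frameMetric, hz.self_of_nhds, inner_smul_left, inner_smul_right, inner_add_right]
    field_simp
    ring
  have hdiff₁ : DifferentiableAt ℝ
      (fun z => (frameMetric γ₁ z)⁻¹ * inner ℂ (γ₁ z) (deriv γ₁ z)) ω := by
    have hr : DifferentiableAt ℝ γ₁ ω := h₁.holo.self_of_nhds.restrictScalars ℝ
    exact ((hr.inner ℂ hr).inv (inner_self_ne_zero.2 h₁.ne_zero.self_of_nhds)).mul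
      (hr.inner ℂ (hγd'.restrictScalars ℝ))
  have hdiff₂ : DifferentiableAt ℂ (fun z => deriv f z / f z) ω :=
    hfd'.div hfd.self_of_nhds hf0.self_of_nhds
  rw [frameCurvature, frameCurvature, wirtingerBar, wirtingerBar, heq₁.fderiv_eq, heq₂.fderiv_eq,
    fderiv_fun_add (hdiff₂.restrictScalars ℝ) hdiff₁]
  simp only [add_apply, fderiv_real_apply hdiff₂, smul_eq_mul]
  linear_combination (-(deriv (fun z => deriv f z / f z) ω) / 2) * Complex.I_sq

theorem IsCowenDouglas.curvature_eq [CompleteSpace E] {Ω : Set ℂ} {T : E →L[ℂ] E}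
    (hT : IsCowenDouglas 1 Ω T) {ω : ℂ} (hω : ω ∈ Ω) {γ : ℂ → E} (h : IsFrameAt T γ ω) :
    curvature T ω = frameCurvature γ ω := by
  have hex : ∃ γ : ℂ → E, IsFrameAt T γ ω := ⟨γ, h⟩
  rw [curvature, dif_pos hex]
  exact hT.frameCurvature_eq hω h hex.choose_spec

/-! ### Reducing subspaces, irreducible and subnormal operators -/

/-- A closed subspace `M` reduces `T` if `M` and its orthogonal complement are `T`-invariant. -/
structure IsReducingSubspace (T : E →L[ℂ] E) (M : Submodule ℂ E) : Prop where
  isClosed : IsClosed (M : Set E)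
  map_mem : ∀ x ∈ M, T x ∈ M
  map_mem_orthogonal : ∀ x ∈ Mᗮ, T x ∈ Mᗮ

/-- `T` is irreducible if its only reducing subspaces are `0` and the whole space. -/
def IsIrreducibleOperator (T : E →L[ℂ] E) : Prop :=
  ∀ M : Submodule ℂ E, IsReducingSubspace T M → M = ⊥ ∨ M = ⊤

/-- `T` is subnormal if it has a normal extension: a Hilbert space `K`, an isometric embedding `V`
of `E` into `K` and a normal operator `N` on `K` that maps the copy of `E` into itself and
restricts to `T` there. -/
def IsSubnormal (T : E →L[ℂ] E) : Prop :=
  ∃ (K : Type u) (_ : NormedAddCommGroup K) (_ : InnerProductSpace ℂ K) (_ : CompleteSpace K)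
    (V : E →ₗᵢ[ℂ] K) (N : K →L[ℂ] K), IsStarNormal N ∧ ∀ x, N (V x) = V (T x)

end Operators

end

/-! The contradiction already appears at the single point `ω = 0`. A normal operator `N` satisfies
`‖N v‖ = ‖N* v‖`, so `ker N = ker N*`, which is the orthogonal complement of the range of `N`. The
orthogonality of kernel and range is inherited by any restriction to an invariant subspace, hence by
a subnormal `T` and by `S = T|M`. If `S` is moreover onto, each vector of `ker S` lies in the range
of `S` and is therefore orthogonal to itself, so `S` is injective. Membership in `B_1` of the disk
makes `S` onto with a one-dimensional kernel, which is impossible. -/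

/-- The kernel of a subnormal operator is orthogonal to its range. -/
theorem IsSubnormal.inner_apply_eq_zero {E : Type*} [NormedAddCommGroup E] [InnerProductSpace ℂ E]
    {T : E →L[ℂ] E} (hT : IsSubnormal T) {x : E} (hx : T x = 0) (y : E) :
    inner ℂ x (T y) = 0 := by
  obtain ⟨K, _, _, _, V, N, hN, hV⟩ := hT
  have hNx : N (V x) = 0 := by rw [hV, hx, map_zero]
  -- Normality enters only here, through `ker N* = ker N`.
  have hadj := (ContinuousLinearMap.IsStarNormal.adjoint_apply_eq_zero_iff hN (V x)).2 hNx
  -- In the larger space, `⟨x, T y⟩ = ⟨V x, N (V y)⟩ = ⟨N* (V x), V y⟩ = 0`.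
  rw [← V.inner_map_map, ← hV, ← ContinuousLinearMap.adjoint_inner_left, hadj, inner_zero_left]

/-- A subnormal operator has no restriction to an invariant subspace that is surjective and has
nonzero kernel. -/
theorem IsSubnormal.ker_restrict_eq_bot {E : Type*} [NormedAddCommGroup E] [InnerProductSpace ℂ E]
    {T : E →L[ℂ] E} (hT : IsSubnormal T) {M : Submodule ℂ E} (hM : ∀ x ∈ M, T x ∈ M)
    (hsurj : Function.Surjective (T.restrict hM)) : (T.restrict hM).ker = ⊥ := by
  refine (Submodule.eq_bot_iff _).2 fun x hx => ?_
  obtain ⟨y, hy⟩ := hsurj x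
  have hTx : T x = 0 := congrArg Subtype.val hx
  have hTy : T y = x := congrArg Subtype.val hy
  -- Since `x = T y` is both in the kernel and in the range, this reads `⟨x, x⟩ = 0`.
  have h := hT.inner_apply_eq_zero hTx y
  rw [hTy, inner_self_eq_zero] at h
  exact Subtype.ext h

theorem mainTheorem8 {H : Type*} [NormedAddCommGroup H] [InnerProductSpace ℂ H] [CompleteSpace H]
    [TopologicalSpace.SeparableSpace H] (T : H →L[ℂ] H) (hirr : IsIrreducibleOperator T)
    (hcontr : ‖T‖ ≤ 1) (M : Submodule ℂ H) (hMclosed : IsClosed (M : Set H))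
    (hMinv : ∀ x ∈ M, T x ∈ M)
    (hB : IsCowenDouglas 1 (Metric.ball (0 : ℂ) 1) (T.restrict hMinv))
    (k : ℕ) (hk : 0 < k)
    (hcurv : ∀ ω ∈ Metric.ball (0 : ℂ) 1,
      curvature (T.restrict hMinv) ω = -(k : ℂ) / (1 - (‖ω‖ : ℂ) ^ 2) ^ 2) :
    ¬ IsSubnormal T := by
  intro hT
  have h0 : (0 : ℂ) ∈ Metric.ball (0 : ℂ) 1 := Metric.mem_ball_self one_pos
  have hsurj := hB.surjective 0 h0
  have hrank := hB.rank_ker 0 h0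
  rw [zero_smul, sub_zero] at hsurj hrank
  -- The kernel at `ω = 0` has rank `1` by the Cowen–Douglas condition and rank `0` by subnormality.
  rw [hT.ker_restrict_eq_bot hMinv hsurj, rank_bot, Nat.cast_one] at hrank
  exact zero_ne_one hrank
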